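/- Let $R$ be a commutative Noetherian ring, $M$ a finitely generated $R$-module and $N$ a submodule of $M$ with $\mathrm{Ass}_R(M/N)=\{\mathfrak p_1,\dots,\mathfrak p_n\}$ ($\mathfrak p_i$ pairwise distinct). Let $N=Q_1\cap\cdots\cap Q_n$ be an irredundant primary decomposition of $N$, where $Q_i$ is $\mathfrak p_i$-primary for all $i$; here "irredundant" means that the primes of the components are pairwise distinct and that no component contains the intersection of the others. For a submodule $L$ of $M$, let $\mathrm{ir}_M(L)$ be the index of reducibility of $L$, that is, the number of components of an irredundant decomposition of $L$ as a finite intersection of irreducible submodules of $M$ (this number does not depend on the decomposition; a proper submodule is irreducible if it is not the intersection of two strictly larger submodules, and $\mathrm{ir}_M(M)=0$). A prime $\mathfrak p\in\mathrm{Ass}_R(M/N)$ is embedded if it is not minimal in $\mathrm{Ass}_R(M/N)$. For $\mathfrak p\in\mathrm{Ass}_R(M/N)$ let $\bigwedge_{\mathfrak p}(N)$ be the set of all $\mathfrak p$-primary submodules of $M$ that appear in some irredundant primary decomposition of $N$; for an embedded prime $\mathfrak p$, a $\mathfrak p$-maximal embedded component of $N$ is an element of $\bigwedge_{\mathfrak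 p}(N)$ that is maximal with respect to inclusion. Then $$\mathrm{ir}_M(N)=\mathrm{ir}_M(Q_1)+\cdots+\mathrm{ir}_M(Q_n)$$ if and only if $Q_i$ is a $\mathfrak p_i$-maximal embedded component of $N$ for every $i$ such that $\mathfrak p_i$ is an embedded associated prime of $N$. -/

import Mathlib

namespace Submodule

variable {R M : Type*} [CommRing R] [AddCommGroup M] [Module R M]

/-- A finite set `s` of submodules is an irredundant irreducible decomposition of `N`: the members
intersect to `N`, each is irreducible, and none contains the intersection of the others. -/
structure IsIrredundantIrreducibleDecomposition (N : Submodule R M)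
    (s : Finset (Submodule R M)) : Prop where
  inf_eq : s.inf id = N
  irreducible : ∀ ⦃J⦄, J ∈ s → InfIrred J
  irredundant : ∀ ⦃J⦄, J ∈ s → ¬ sInf ((s : Set (Submodule R M)) \ {J}) ≤ J

/-- The index of reducibility of `N` in `M`: the number of components of an irredundant irreducible
decomposition of `N`. In a Noetherian module such decompositions exist
(`exists_irredundantIrreducibleDecomposition`) and all have this number of components
(`IsIrredundantIrreducibleDecomposition.card_eq`), so the infimum is over a singleton. -/
noncomputable def indexOfReducibility (N : Submodule R M) : ℕ :=
  sInf {k | ∃ s : Finset (Submodule R M),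
    N.IsIrredundantIrreducibleDecomposition s ∧ s.card = k}

/-- The set of `p`-primary submodules of `M` that appear in an irredundant primary decomposition
of `N`. -/
def primaryComponents (N : Submodule R M) (p : Ideal R) : Set (Submodule R M) :=
  {Q | Q.IsPrimary ∧ (Q.colon Set.univ).radical = p ∧
    ∃ t : Finset (Submodule R M), N.IsMinimalPrimaryDecomposition t ∧ Q ∈ t}

/-- `p` is an embedded associated prime of `N`: an associated prime of `M ⧸ N` that is not minimal
among the associated primes of `M ⧸ N`. -/
def IsEmbeddedPrime (N : Submodule R M) (p : Ideal R) : Prop :=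
  p ∈ associatedPrimes R (M ⧸ N) ∧ ¬ Minimal (· ∈ associatedPrimes R (M ⧸ N)) p

/-- `Q` is a `p`-maximal embedded component of `N`: a maximal element, with respect to inclusion,
of the set of `p`-primary components of `N`. -/
def IsMaximalEmbeddedComponent (N : Submodule R M) (p : Ideal R) (Q : Submodule R M) : Prop :=
  Maximal (· ∈ N.primaryComponents p) Q

section WellDefined

theorem exists_irredundantIrreducibleDecomposition [IsNoetherian R M] (N : Submodule R M) :
    ∃ s : Finset (Submodule R M), N.IsIrredundantIrreducibleDecomposition s := by
  classical
  obtain ⟨s, hs, hirr⟩ := exists_infIrred_decomposition N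
  obtain ⟨t, hts, ht, h⟩ := decomposition_erase_inf hs
  refine ⟨t, ht, fun J hJ ↦ hirr (hts hJ), fun J hJ hle ↦ h hJ ?_⟩
  rwa [Finset.inf_id_eq_sInf, Finset.coe_erase]

theorem exists_replace {N x c : Submodule R M} (hx : InfIrred x) (hxc : x ⊓ c = N)
    {t : Finset (Submodule R M)} (ht : t.inf id = N) : ∃ y ∈ t, c ⊓ y = N := by
  classical
  have key : ∀ u v : Submodule R M, N ≤ u → u ≤ c → N ≤ v → v ≤ c → u ⊓ v = N →
      u = N ∨ v = N := by
    intro u v hu huc hv hvc huv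
    have aux : ∀ z : Submodule R M, N ≤ z → z ≤ c → (x ⊔ z) ⊓ c = z := by
      intro z hz hzc
      rw [sup_comm, sup_inf_assoc_of_le x hzc, hxc, sup_eq_left.mpr hz]
    have hw : (x ⊔ u) ⊓ (x ⊔ v) = x := by
      have h1 : ((x ⊔ u) ⊓ (x ⊔ v)) ⊓ c = N := by
        rw [inf_inf_distrib_right, aux u hu huc, aux v hv hvc, huv]
      have h2 : (x ⊔ u) ⊓ (x ⊔ v) ≤ x ⊔ c := inf_le_left.trans (sup_le_sup_left huc x)
      have h3 : x ≤ (x ⊔ u) ⊓ (x ⊔ v) := le_inf le_sup_left le_sup_left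
      calc (x ⊔ u) ⊓ (x ⊔ v) = (x ⊔ c) ⊓ ((x ⊔ u) ⊓ (x ⊔ v)) := (inf_eq_right.mpr h2).symm
        _ = x ⊔ c ⊓ ((x ⊔ u) ⊓ (x ⊔ v)) := sup_inf_assoc_of_le c h3
        _ = x := by rw [inf_comm c, h1, sup_eq_left, ← hxc]; exact inf_le_left
    refine (hx.2 hw).imp (fun h ↦ ?_) (fun h ↦ ?_)
    · exact le_antisymm (hxc ▸ le_inf (sup_eq_left.mp h) huc) hu
    · exact le_antisymm (hxc ▸ le_inf (sup_eq_left.mp h) hvc) hv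
  have hNc : N ≤ c := hxc ▸ inf_le_right
  have main : ∀ s ⊆ t, c ⊓ s.inf id = N → c = N ∨ ∃ y ∈ s, c ⊓ y = N := by
    intro s
    induction s using Finset.induction_on with
    | empty => intro _ h; left; simpa using h
    | insert y s _ ih =>
      intro hst h
      have hyN : N ≤ y := ht ▸ Finset.inf_le (hst (Finset.mem_insert_self y s))
      have hsN : N ≤ s.inf id :=
        ht ▸ Finset.inf_mono ((Finset.subset_insert y s).trans hst)
      rw [Finset.inf_insert, id, inf_inf_distrib_left] at h
      rcases key _ _ (le_inf hNc hyN) inf_le_left (le_inf hNc hsN) inf_le_left h with h | h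
      · exact Or.inr ⟨y, Finset.mem_insert_self y s, h⟩
      · exact (ih ((Finset.subset_insert y s).trans hst) h).imp id
          fun ⟨z, hz, h⟩ ↦ ⟨z, Finset.mem_insert_of_mem hz, h⟩
  rcases main t subset_rfl (by rw [ht, inf_eq_right.mpr hNc]) with h | h
  · rcases t.eq_empty_or_nonempty with rfl | ⟨y, hy⟩
    · refine absurd ?_ hx.ne_top
      rw [← top_le_iff, ← Finset.inf_empty (f := id), ht, ← hxc]
      exact inf_le_left
    · refine ⟨y, hy, ?_⟩
      rw [h, inf_eq_left, ← ht]
      exact Finset.inf_le hy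
  · exact h

namespace IsIrredundantIrreducibleDecomposition

theorem card_le {N : Submodule R M} {s t : Finset (Submodule R M)}
    (hs : N.IsIrredundantIrreducibleDecomposition s)
    (ht : N.IsIrredundantIrreducibleDecomposition t) : t.card ≤ s.card := by
  classical
  have main : ∀ s : Finset (Submodule R M), (∀ J ∈ s, InfIrred J) → ∀ c : Submodule R M,
      s.inf id ⊓ c = N → ∃ v ⊆ t, v.card ≤ s.card ∧ v.inf id ⊓ c = N := by
    intro s
    induction s using Finset.induction_on with
    | empty => intro _ c h; exact ⟨∅, by simp, by simp, h⟩
    | insert x s hxs ih =>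
      intro hirr c h
      rw [Finset.inf_insert, id, inf_assoc] at h
      obtain ⟨y, hy, hyN⟩ := exists_replace (hirr x (Finset.mem_insert_self x s)) h ht.inf_eq
      obtain ⟨v, hvt, hcard, hv⟩ := ih (fun J hJ ↦ hirr J (Finset.mem_insert_of_mem hJ)) (c ⊓ y)
        (by rw [← inf_assoc, hyN])
      refine ⟨insert y v, Finset.insert_subset hy hvt, ?_, ?_⟩
      · rw [Finset.card_insert_of_notMem hxs]
        exact (Finset.card_insert_le y v).trans (by omega)
      · rw [Finset.inf_insert, id, ← hv, inf_comm c, inf_left_comm, inf_assoc]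
  obtain ⟨v, hvt, hcard, hv⟩ := main s (fun J hJ ↦ hs.irreducible hJ) ⊤ (by simp [hs.inf_eq])
  suffices v = t by rwa [← this]
  refine hvt.antisymm fun J hJ ↦ ?_
  by_contra hJv
  refine ht.irredundant hJ ?_
  calc sInf ((t : Set (Submodule R M)) \ {J}) ≤ sInf (v : Set (Submodule R M)) :=
        sInf_le_sInf fun K hK ↦ ⟨hvt hK, fun h ↦ hJv (h ▸ hK)⟩
    _ = N := by rw [← Finset.inf_id_eq_sInf, ← hv, inf_top_eq]
    _ ≤ J := ht.inf_eq ▸ Finset.inf_le hJ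

/-- Noether: all irredundant irreducible decompositions of `N` have the same number of components,
the index of reducibility. -/
theorem card_eq {N : Submodule R M} {s : Finset (Submodule R M)}
    (hs : N.IsIrredundantIrreducibleDecomposition s) : s.card = N.indexOfReducibility := by
  obtain ⟨t, ht, h⟩ := Nat.sInf_mem (s := {k | ∃ s : Finset (Submodule R M),
    N.IsIrredundantIrreducibleDecomposition s ∧ s.card = k}) ⟨_, s, hs, rfl⟩
  rw [indexOfReducibility, ← h]
  exact le_antisymm (ht.card_le hs) (hs.card_le ht)

end IsIrredundantIrreducibleDecomposition

end WellDefined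

end Submodule

/-
For every finite family, `ir(⋂ Qᵢ) ≤ ∑ ir(Qᵢ)`, with equality if and only if no `Qᵢ` is strictly
contained in a submodule `L` with `L ∩ c ⊆ Qᵢ`, where `c = ⋂_{j ≠ i} Q_j`. Indeed, given such `L`,
the modular law writes `Qᵢ = L ∩ (c + Qᵢ)`, so `Qᵢ` has an irredundant irreducible decomposition
with a component containing `c`, and this component is superfluous in `Qᵢ ∩ c`. If there is no such
`L` for any `i`, then the union of irredundant decompositions of the `Qᵢ` is irredundant.

In a minimal primary decomposition, the saturation at `pᵢ` of a submodule `L ⊇ Qᵢ` with `L ∩ c ⊆ Qᵢ`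
is a `pᵢ`-primary component of `N`; so the condition on `Qᵢ` is its maximality among these
components. If `pᵢ` is a minimal associated prime, some element outside `pᵢ` maps `M` into `c`,
hence `L` into `Qᵢ`, and the condition holds automatically.
-/

namespace IndexOfReducibility

open Submodule

theorem apply_inf_inf_erase {α ι : Type*} [SemilatticeInf α] [OrderTop α] [DecidableEq ι]
    {s : Finset ι} {i : ι} (hi : i ∈ s) (f : ι → α) : f i ⊓ (s.erase i).inf f = s.inf f := by
  rw [← Finset.inf_insert, Finset.insert_erase hi]

section IrreducibleDecomposition

variable {R M : Type*} [CommRing R] [AddCommGroup M] [Module R M]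

theorem exists_subset_isIrredundantIrreducibleDecomposition {N : Submodule R M}
    {s : Finset (Submodule R M)} (hs : s.inf id = N) (hirr : ∀ J ∈ s, InfIrred J) :
    ∃ t ⊆ s, N.IsIrredundantIrreducibleDecomposition t := by
  obtain ⟨t, hts, ht, hmin⟩ := decomposition_erase_inf hs
  refine ⟨t, hts, ht, fun J hJ ↦ hirr J (hts hJ), fun J hJ ↦ ?_⟩
  rw [← Finset.coe_erase, ← Finset.inf_id_eq_sInf]
  exact hmin hJ

theorem indexOfReducibility_le_card {N : Submodule R M} {s : Finset (Submodule R M)}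
    (hs : s.inf id = N) (hirr : ∀ J ∈ s, InfIrred J) : N.indexOfReducibility ≤ s.card := by
  obtain ⟨t, hts, ht⟩ := exists_subset_isIrredundantIrreducibleDecomposition hs hirr
  exact ht.card_eq ▸ Finset.card_le_card hts

theorem exists_subset_union_isIrredundantIrreducibleDecomposition {A B : Submodule R M}
    {s t : Finset (Submodule R M)} (hs : A.IsIrredundantIrreducibleDecomposition s)
    (ht : B.IsIrredundantIrreducibleDecomposition t) :
    ∃ u ⊆ s ∪ t, (A ⊓ B).IsIrredundantIrreducibleDecomposition u := by
  refine exists_subset_isIrredundantIrreducibleDecomposition ?_ fun J hJ ↦ ?_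
  · rw [Finset.inf_union, hs.inf_eq, ht.inf_eq]
  · exact (Finset.mem_union.mp hJ).elim (fun h ↦ hs.irreducible h) fun h ↦ ht.irreducible h

theorem le_of_mem_isIrredundantIrreducibleDecomposition {N J : Submodule R M}
    {s : Finset (Submodule R M)} (hs : N.IsIrredundantIrreducibleDecomposition s) (hJ : J ∈ s) :
    N ≤ J :=
  hs.inf_eq ▸ Finset.inf_le (f := id) hJ

theorem not_inf_erase_inf_le_of_maximal {N c J : Submodule R M} {s : Finset (Submodule R M)}
    (hs : N.IsIrredundantIrreducibleDecomposition s) (hmax : Maximal (· ⊓ c ≤ N) N)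
    (hJ : J ∈ s) : ¬ (s.erase J).inf id ⊓ c ≤ J := by
  intro hle
  have hN : J ⊓ (s.erase J).inf id = N := hs.inf_eq ▸ apply_inf_inf_erase hJ id
  have herase : (s.erase J).inf id ≤ N :=
    hmax.2 ((le_inf hle inf_le_left).trans_eq hN) (hN ▸ inf_le_right)
  refine hs.irredundant hJ ?_
  rw [← Finset.coe_erase, ← Finset.inf_id_eq_sInf]
  exact herase.trans (le_of_mem_isIrredundantIrreducibleDecomposition hs hJ)

section FiniteFamily

variable {ι : Type*} [DecidableEq ι] {s : Finset ι} {Q : ι → Submodule R M}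
  {t : ι → Finset (Submodule R M)}

theorem inf_erase_le_of_mem (ht : ∀ i ∈ s, (Q i).IsIrredundantIrreducibleDecomposition (t i))
    {i j : ι} (hj : j ∈ s) (hji : j ≠ i) {J : Submodule R M} (hJ : J ∈ t j) :
    (s.erase i).inf Q ≤ J :=
  (Finset.inf_le (Finset.mem_erase.mpr ⟨hji, hj⟩)).trans
    (le_of_mem_isIrredundantIrreducibleDecomposition (ht j hj) hJ)

theorem pairwiseDisjoint_of_maximal
    (ht : ∀ i ∈ s, (Q i).IsIrredundantIrreducibleDecomposition (t i))
    (hmax : ∀ i ∈ s, Maximal (· ⊓ (s.erase i).inf Q ≤ Q i) (Q i)) :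
    (s : Set ι).PairwiseDisjoint t := by
  refine fun i hi j hj hij ↦ Finset.disjoint_left.mpr fun J hJi hJj ↦ ?_
  exact not_inf_erase_inf_le_of_maximal (ht i hi) (hmax i hi) hJi
    (inf_le_right.trans (inf_erase_le_of_mem ht hj hij.symm hJj))

theorem isIrredundantIrreducibleDecomposition_biUnion
    (ht : ∀ i ∈ s, (Q i).IsIrredundantIrreducibleDecomposition (t i))
    (hmax : ∀ i ∈ s, Maximal (· ⊓ (s.erase i).inf Q ≤ Q i) (Q i)) :
    (s.inf Q).IsIrredundantIrreducibleDecomposition (s.biUnion t) where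
  inf_eq := by
    rw [Finset.inf_biUnion]
    exact Finset.inf_congr rfl fun i hi ↦ (ht i hi).inf_eq
  irreducible J hJ := by
    obtain ⟨i, hi, hJi⟩ := Finset.mem_biUnion.mp hJ
    exact (ht i hi).irreducible hJi
  irredundant J hJ hle := by
    obtain ⟨i, hi, hJi⟩ := Finset.mem_biUnion.mp hJ
    refine not_inf_erase_inf_le_of_maximal (ht i hi) (hmax i hi) hJi (le_trans (le_sInf ?_) hle)
    rintro K ⟨hK, hKJ⟩
    obtain ⟨j, hj, hKj⟩ := Finset.mem_biUnion.mp hK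
    rcases eq_or_ne j i with rfl | hji
    · exact inf_le_left.trans (Finset.inf_le (f := id) (Finset.mem_erase.mpr ⟨hKJ, hKj⟩))
    · exact inf_le_right.trans (inf_erase_le_of_mem ht hj hji hKj)

end FiniteFamily

variable [IsNoetherian R M]

theorem indexOfReducibility_inf_le (A B : Submodule R M) :
    (A ⊓ B).indexOfReducibility ≤ A.indexOfReducibility + B.indexOfReducibility := by
  obtain ⟨s, hs⟩ := exists_irredundantIrreducibleDecomposition A
  obtain ⟨t, ht⟩ := exists_irredundantIrreducibleDecomposition B
  obtain ⟨u, hu, hdec⟩ := exists_subset_union_isIrredundantIrreducibleDecomposition hs ht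
  rw [← hs.card_eq, ← ht.card_eq, ← hdec.card_eq]
  exact (Finset.card_le_card hu).trans (Finset.card_union_le s t)

theorem indexOfReducibility_finsetInf_le {ι : Type*} (s : Finset ι) (Q : ι → Submodule R M) :
    (s.inf Q).indexOfReducibility ≤ ∑ i ∈ s, (Q i).indexOfReducibility := by
  classical
  induction s using Finset.induction_on with
  | empty => exact indexOfReducibility_le_card Finset.inf_empty (by simp)
  | insert i s hi ih =>
    rw [Finset.inf_insert, Finset.sum_insert hi]
    exact (indexOfReducibility_inf_le _ _).trans (by gcongr)

theorem exists_isIrredundantIrreducibleDecomposition_mem_ge {c Q L : Submodule R M}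
    (hQL : Q < L) (hc : L ⊓ c ≤ Q) :
    ∃ t, Q.IsIrredundantIrreducibleDecomposition t ∧ ∃ J ∈ t, c ≤ J := by
  obtain ⟨u, hu⟩ := exists_irredundantIrreducibleDecomposition L
  obtain ⟨v, hv⟩ := exists_irredundantIrreducibleDecomposition (c ⊔ Q)
  have hQ : L ⊓ (c ⊔ Q) = Q := by
    rw [← inf_sup_assoc_of_le c hQL.le, sup_eq_right]
    exact hc
  obtain ⟨t, htuv, ht⟩ := exists_subset_union_isIrredundantIrreducibleDecomposition hu hv
  rw [hQ] at ht
  obtain ⟨J, hJ, hJu⟩ : ∃ J ∈ t, J ∉ u := by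
    by_contra! htu
    exact hQL.not_ge (hu.inf_eq ▸ ht.inf_eq ▸ Finset.inf_mono htu)
  have hJv : J ∈ v := (Finset.mem_union.mp (htuv hJ)).resolve_left hJu
  exact ⟨t, ht, J, hJ, le_sup_left.trans (le_of_mem_isIrredundantIrreducibleDecomposition hv hJv)⟩

theorem indexOfReducibility_inf_lt {c Q L : Submodule R M} (hQL : Q < L) (hc : L ⊓ c ≤ Q) :
    (Q ⊓ c).indexOfReducibility < Q.indexOfReducibility + c.indexOfReducibility := by
  obtain ⟨t, ht, J, hJ, hcJ⟩ := exists_isIrredundantIrreducibleDecomposition_mem_ge hQL hc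
  have hinf : Q ⊓ c = (t.erase J).inf id ⊓ c := by
    rw [← ht.inf_eq, ← apply_inf_inf_erase hJ id, inf_assoc]
    exact inf_eq_right.mpr (inf_le_right.trans hcJ)
  calc (Q ⊓ c).indexOfReducibility
      ≤ ((t.erase J).inf id).indexOfReducibility + c.indexOfReducibility :=
        hinf ▸ indexOfReducibility_inf_le _ c
    _ ≤ (t.erase J).card + c.indexOfReducibility := by
        gcongr
        exact indexOfReducibility_le_card rfl
          fun K hK ↦ ht.irreducible (Finset.mem_of_mem_erase hK)
    _ < t.card + c.indexOfReducibility := by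
        gcongr
        exact Finset.erase_ssubset hJ
    _ = Q.indexOfReducibility + c.indexOfReducibility := by rw [ht.card_eq]

theorem indexOfReducibility_finsetInf_eq_sum_iff {ι : Type*} [DecidableEq ι] (s : Finset ι)
    (Q : ι → Submodule R M) :
    (s.inf Q).indexOfReducibility = ∑ i ∈ s, (Q i).indexOfReducibility ↔
      ∀ i ∈ s, Maximal (· ⊓ (s.erase i).inf Q ≤ Q i) (Q i) := by
  constructor
  · refine fun hsum i hi ↦ ⟨inf_le_left, fun L hL hle ↦ ?_⟩
    by_contra hnot
    refine hsum.not_lt ?_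
    calc (s.inf Q).indexOfReducibility = (Q i ⊓ (s.erase i).inf Q).indexOfReducibility := by
          rw [apply_inf_inf_erase hi]
      _ < (Q i).indexOfReducibility + ((s.erase i).inf Q).indexOfReducibility :=
          indexOfReducibility_inf_lt (lt_of_le_not_ge hle hnot) hL
      _ ≤ (Q i).indexOfReducibility + ∑ j ∈ s.erase i, (Q j).indexOfReducibility := by
          gcongr
          exact indexOfReducibility_finsetInf_le _ Q
      _ = ∑ j ∈ s, (Q j).indexOfReducibility :=
          Finset.add_sum_erase s (fun j ↦ (Q j).indexOfReducibility) hi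
  · intro hmax
    choose t ht using fun i ↦ exists_irredundantIrreducibleDecomposition (Q i)
    rw [← (isIrredundantIrreducibleDecomposition_biUnion (fun i _ ↦ ht i) hmax).card_eq,
      Finset.card_biUnion (pairwiseDisjoint_of_maximal (fun i _ ↦ ht i) hmax)]
    exact Finset.sum_congr rfl fun i _ ↦ (ht i).card_eq

end IrreducibleDecomposition

section Saturation

variable {R M : Type*} [CommSemiring R] [AddCommMonoid M] [Module R M]

/-- The saturation of a submodule `L` of `M` with respect to a multiplicative set `S`, that is, the
preimage in `M` of the localization `S⁻¹L` of `L`. -/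
def saturation (S : Submonoid R) (L : Submodule R M) : Submodule R M where
  carrier := {x | ∃ s ∈ S, s • x ∈ L}
  zero_mem' := ⟨1, S.one_mem, by rw [smul_zero]; exact L.zero_mem⟩
  add_mem' := by
    rintro x y ⟨s, hs, hx⟩ ⟨r, hr, hy⟩
    refine ⟨s * r, S.mul_mem hs hr, ?_⟩
    rw [smul_add]
    exact L.add_mem (mul_comm s r ▸ mul_smul r s x ▸ L.smul_mem r hx)
      (mul_smul s r y ▸ L.smul_mem s hy)
  smul_mem' := by
    rintro r x ⟨s, hs, hx⟩
    exact ⟨s, hs, smul_comm r s x ▸ L.smul_mem r hx⟩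

theorem le_saturation (S : Submonoid R) (L : Submodule R M) : L ≤ saturation S L :=
  fun x hx ↦ ⟨1, S.one_mem, (one_smul R x).symm ▸ hx⟩

theorem mem_saturation_of_smul_mem {S : Submonoid R} {L : Submodule R M} {r : R} {x : M}
    (hr : r ∈ S) (hx : r • x ∈ saturation S L) : x ∈ saturation S L := by
  obtain ⟨s, hs, hsx⟩ := hx
  exact ⟨s * r, S.mul_mem hs hr, mul_smul s r x ▸ hsx⟩

theorem saturation_inf_le_of_isPrimary {q L c : Submodule R M} (hq : q.IsPrimary) {S : Submonoid R}
    (hS : ∀ s ∈ S, s ∉ (q.colon Set.univ).radical) (hL : L ⊓ c ≤ q) : saturation S L ⊓ c ≤ q := by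
  rintro x ⟨⟨s, hs, hsx⟩, hxc⟩
  exact (hq.mem_or_mem (hL ⟨hsx, c.smul_mem s hxc⟩)).resolve_right (hS s hs)

variable {L : Submodule R M} {p : Ideal R} [hp : p.IsPrime]

theorem radical_colon_saturation_primeCompl (hpL : p ≤ (L.colon Set.univ).radical)
    (htop : saturation p.primeCompl L ≠ ⊤) :
    ((saturation p.primeCompl L).colon Set.univ).radical = p := by
  refine le_antisymm (hp.radical_le_iff.mpr fun r hr ↦ ?_)
    (hpL.trans (Ideal.radical_mono (colon_mono (le_saturation _ L) subset_rfl)))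
  by_contra hrp
  exact htop (eq_top_iff.mpr fun x _ ↦
    mem_saturation_of_smul_mem (S := p.primeCompl) hrp (mem_colon.mp hr x (Set.mem_univ x)))

theorem isPrimary_saturation_primeCompl (hpL : p ≤ (L.colon Set.univ).radical)
    (htop : saturation p.primeCompl L ≠ ⊤) : (saturation p.primeCompl L).IsPrimary := by
  refine ⟨htop, fun {r x} hrx ↦ ?_⟩
  by_cases hr : r ∈ p
  · rw [← radical_colon_saturation_primeCompl hpL htop] at hr
    obtain ⟨k, hk⟩ := hr
    exact Or.inr ⟨k, mem_colon_iff_le.mp hk⟩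
  · exact Or.inl (mem_saturation_of_smul_mem hr hrx)

end Saturation

section PrimaryDecomposition

variable {R M : Type*} [CommSemiring R] [AddCommMonoid M] [Module R M] {N q : Submodule R M}
  {t : Finset (Submodule R M)}

theorem inf_inf_erase_of_isMinimalPrimaryDecomposition (ht : N.IsMinimalPrimaryDecomposition t)
    (hq : q ∈ t) : q ⊓ (t.erase q).inf id = N :=
  ht.inf_eq ▸ apply_inf_inf_erase hq id

theorem radical_colon_singleton_of_mem_inf_erase (ht : N.IsMinimalPrimaryDecomposition t)
    (hq : q ∈ t) {x : M} (hxq : x ∉ q) (hx : x ∈ (t.erase q).inf id) :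
    (N.colon {x}).radical = (q.colon Set.univ).radical := by
  rw [← inf_inf_erase_of_isMinimalPrimaryDecomposition ht hq,
    colon_inf_eq_left_of_subset (Set.singleton_subset_iff.mpr hx),
    (ht.primary hq).radical_colon_singleton_of_notMem hxq]

theorem exists_mem_radical_colon_univ_eq (ht : N.IsMinimalPrimaryDecomposition t) {x : M}
    (hx : (N.colon {x}).radical.IsPrime) :
    ∃ q ∈ t, x ∉ q ∧ (q.colon Set.univ).radical = (N.colon {x}).radical := by
  classical
  have hinf : (N.colon {x}).radical =
      (t.filter (x ∉ ·)).inf fun J ↦ (J.colon Set.univ).radical := by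
    simp_rw [← ht.inf_eq, colon_finsetInf, ← Ideal.radicalInfTopHom_apply, map_finset_inf,
      Function.comp_def, Ideal.radicalInfTopHom_apply, id_eq]
    rw [Finset.inf_congr rfl fun J hJ ↦ (ht.primary hJ).radical_colon_singleton_eq_ite x,
      Finset.inf_ite, Finset.inf_top, top_inf_eq]
  rw [hinf] at hx ⊢
  obtain ⟨q, hq, hqx⟩ := Ideal.eq_inf_of_isPrime_inf hx
  exact ⟨q, Finset.mem_of_mem_filter q hq, (Finset.mem_filter.mp hq).2, hqx⟩

theorem inf_inf_erase_le_of_radical_eq {t' : Finset (Submodule R M)} {q' : Submodule R M}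
    (ht : N.IsMinimalPrimaryDecomposition t) (ht' : N.IsMinimalPrimaryDecomposition t')
    (hq : q ∈ t) (hq' : q' ∈ t') (hrad : (q'.colon Set.univ).radical = (q.colon Set.univ).radical) :
    q' ⊓ (t.erase q).inf id ≤ q := by
  rintro x ⟨hxq', hxc⟩
  by_contra hxq
  have hcolon := radical_colon_singleton_of_mem_inf_erase ht hq hxq hxc
  obtain ⟨J, hJ, hxJ, hJx⟩ := exists_mem_radical_colon_univ_eq ht'
    (hcolon ▸ (ht.primary hq).isPrime_radical_colon)
  have hJq' : J = q' := ht'.injOn _ _ hJ hq' (hJx.trans (hcolon.trans hrad.symm))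
  exact hxJ (hJq' ▸ hxq')

theorem isMinimalPrimaryDecomposition_insert_erase {q' : Submodule R M}
    (ht : N.IsMinimalPrimaryDecomposition t) (hq : q ∈ t) (hle : q ≤ q') (hq' : q'.IsPrimary)
    (hrad : (q'.colon Set.univ).radical = (q.colon Set.univ).radical)
    (hinf : q' ⊓ (t.erase q).inf id ≤ q) :
    N.IsMinimalPrimaryDecomposition (insert q' (t.erase q)) where
  inf_eq := by
    rw [Finset.inf_insert, ← inf_inf_erase_of_isMinimalPrimaryDecomposition ht hq]
    exact le_antisymm (le_inf hinf inf_le_right) (inf_le_inf_right _ hle)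
  primary := (Finset.forall_mem_insert ..).mpr
    ⟨hq', fun _ hJ ↦ ht.primary (Finset.mem_of_mem_erase hJ)⟩
  distinct := by
    rw [Finset.coe_insert, Set.pairwise_insert_of_symm]
    refine ⟨ht.distinct.mono (Finset.coe_subset.mpr (Finset.erase_subset q t)), fun J hJ _ ↦ ?_⟩
    obtain ⟨hJq, hJt⟩ := Finset.mem_erase.mp hJ
    exact fun hJrad ↦ ht.distinct hq hJt hJq.symm (hrad.symm.trans hJrad)
  minimal := by
    have hq't : q' ∉ t.erase q := fun h ↦
      (Finset.mem_erase.mp h).1 (ht.injOn _ _ (Finset.mem_of_mem_erase h) hq hrad)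
    refine (Finset.forall_mem_insert ..).mpr ⟨fun h ↦ ?_, fun J hJ h ↦ ?_⟩
    · rw [Finset.erase_insert hq't] at h
      exact ht.minimal hq ((le_inf h le_rfl).trans hinf)
    · obtain ⟨hJq, hJt⟩ := Finset.mem_erase.mp hJ
      refine ht.minimal hJt ((Finset.le_inf fun K hK ↦ ?_).trans h)
      obtain ⟨hKJ, hK⟩ := Finset.mem_erase.mp hK
      rcases Finset.mem_insert.mp hK with rfl | hK
      · exact (Finset.inf_le (Finset.mem_erase.mpr ⟨hJq.symm, hq⟩)).trans hle
      · exact Finset.inf_le (Finset.mem_erase.mpr ⟨hKJ, Finset.mem_of_mem_erase hK⟩)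

theorem exists_mem_colon_inf_erase_notMem_radical (ht : N.IsMinimalPrimaryDecomposition t)
    (hq : q ∈ t) (hmin : Minimal (· ∈ N.associatedPrimes) (q.colon Set.univ).radical) :
    ∃ s ∈ ((t.erase q).inf id).colon Set.univ, s ∉ (q.colon Set.univ).radical := by
  have hprime := (ht.primary hq).isPrime_radical_colon
  refine SetLike.not_le_iff_exists.mp fun hcolon ↦ ?_
  rw [colon_finsetInf, hprime.inf_le'] at hcolon
  obtain ⟨J, hJ, hJq⟩ := hcolon
  obtain ⟨hJne, hJt⟩ := Finset.mem_erase.mp hJ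
  have hle := hprime.radical_le_iff.mpr hJq
  exact hJne (ht.injOn _ _ hJt hq (hle.antisymm (hmin.2 (ht.mem_associatedPrimes hJt) hle)))

theorem maximal_inf_erase_le_of_minimal (ht : N.IsMinimalPrimaryDecomposition t) (hq : q ∈ t)
    (hmin : Minimal (· ∈ N.associatedPrimes) (q.colon Set.univ).radical) :
    Maximal (· ⊓ (t.erase q).inf id ≤ q) q := by
  refine ⟨inf_le_left, fun L hL _ x hx ↦ ?_⟩
  obtain ⟨s, hs, hsq⟩ := exists_mem_colon_inf_erase_notMem_radical ht hq hmin
  have hsx : s • x ∈ q := hL ⟨L.smul_mem s hx, mem_colon.mp hs x (Set.mem_univ x)⟩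
  exact ((ht.primary hq).mem_or_mem hsx).resolve_right hsq

end PrimaryDecomposition

section PrimaryComponents

variable {R M : Type*} [CommRing R] [AddCommGroup M] [Module R M] {N q : Submodule R M}
  {t : Finset (Submodule R M)}

theorem associatedPrimes_quotient (N : Submodule R M) :
    associatedPrimes R (M ⧸ N) = N.associatedPrimes := by
  have hcolon (x : M) : (⊥ : Submodule R (M ⧸ N)).colon {N.mkQ x} = N.colon {x} := by
    ext r
    rw [mem_colon_singleton, mem_colon_singleton, ← map_smul, mem_bot, mkQ_apply,
      Quotient.mk_eq_zero]
  ext I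
  rw [AssociatedPrimes.mem_iff, IsAssociatedPrime, Submodule.isAssociatedPrime_def,
    AssociatePrimes.mem_iff, Submodule.isAssociatedPrime_def, N.mkQ_surjective.exists]
  simp_rw [hcolon]

theorem saturation_primeCompl_mem_primaryComponents (ht : N.IsMinimalPrimaryDecomposition t)
    (hq : q ∈ t) {p : Ideal R} [p.IsPrime] (hp : (q.colon Set.univ).radical = p)
    {L : Submodule R M} (hle : q ≤ L) (hinf : L ⊓ (t.erase q).inf id ≤ q) :
    saturation p.primeCompl L ∈ N.primaryComponents p := by
  have hle' : q ≤ saturation p.primeCompl L := hle.trans (le_saturation _ L)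
  have hinf' : saturation p.primeCompl L ⊓ (t.erase q).inf id ≤ q :=
    saturation_inf_le_of_isPrimary (ht.primary hq) (fun _ hs ↦ hp ▸ hs) hinf
  have htop : saturation p.primeCompl L ≠ ⊤ := fun htop ↦
    ht.minimal hq (by rwa [htop, top_inf_eq] at hinf')
  have hpL : p ≤ (L.colon Set.univ).radical :=
    hp ▸ Ideal.radical_mono (colon_mono hle subset_rfl)
  have hprim := isPrimary_saturation_primeCompl hpL htop
  have hrad := radical_colon_saturation_primeCompl hpL htop
  exact ⟨hprim, hrad, _, isMinimalPrimaryDecomposition_insert_erase ht hq hle' hprim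
    (hrad.trans hp.symm) hinf', Finset.mem_insert_self _ _⟩

theorem isMaximalEmbeddedComponent_iff (ht : N.IsMinimalPrimaryDecomposition t) (hq : q ∈ t) :
    N.IsMaximalEmbeddedComponent (q.colon Set.univ).radical q ↔
      Maximal (· ⊓ (t.erase q).inf id ≤ q) q := by
  have := (ht.primary hq).isPrime_radical_colon
  refine ⟨fun hmax ↦ ⟨inf_le_left, fun L hL hle ↦ ?_⟩,
    fun hmax ↦ ⟨⟨ht.primary hq, rfl, t, ht, hq⟩, ?_⟩⟩
  · have hmem := saturation_primeCompl_mem_primaryComponents ht hq rfl hle hL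
    exact (le_saturation _ L).trans (hmax.2 hmem (hle.trans (le_saturation _ L)))
  · rintro q' ⟨-, hrad, t', ht', hq'⟩ hle
    exact hmax.2 (inf_inf_erase_le_of_radical_eq ht ht' hq hq' hrad) hle

theorem maximal_inf_erase_le_iff (ht : N.IsMinimalPrimaryDecomposition t) (hq : q ∈ t) :
    Maximal (· ⊓ (t.erase q).inf id ≤ q) q ↔
      (N.IsEmbeddedPrime (q.colon Set.univ).radical →
        N.IsMaximalEmbeddedComponent (q.colon Set.univ).radical q) := by
  rw [isMaximalEmbeddedComponent_iff ht hq]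
  refine ⟨fun hmax _ ↦ hmax, fun hmax ↦ ?_⟩
  by_cases hmin : Minimal (· ∈ N.associatedPrimes) (q.colon Set.univ).radical
  · exact maximal_inf_erase_le_of_minimal ht hq hmin
  · refine hmax ?_
    rw [IsEmbeddedPrime, associatedPrimes_quotient]
    exact ⟨ht.mem_associatedPrimes hq, hmin⟩

end PrimaryComponents

end IndexOfReducibility

open IndexOfReducibility in
theorem theorem3p2_general {R M : Type*} [CommRing R] [AddCommGroup M] [Module R M]
    [IsNoetherian R M] {N : Submodule R M} {t : Finset (Submodule R M)}
    (ht : N.IsMinimalPrimaryDecomposition t) :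
    N.indexOfReducibility = ∑ q ∈ t, q.indexOfReducibility ↔
      ∀ q ∈ t, N.IsEmbeddedPrime (q.colon Set.univ).radical →
        N.IsMaximalEmbeddedComponent (q.colon Set.univ).radical q := by
  have hsum := indexOfReducibility_finsetInf_eq_sum_iff t id
  rw [ht.inf_eq] at hsum
  exact hsum.trans (forall₂_congr fun q hq ↦ maximal_inf_erase_le_iff ht hq)

theorem theorem3p2 {R M : Type*} [CommRing R] [IsNoetherianRing R] [AddCommGroup M] [Module R M]
    [Module.Finite R M] (N : Submodule R M) (n : ℕ) (p : Fin n → Ideal R)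
    (Q : Fin n ↪ Submodule R M)
    (hQ : N.IsMinimalPrimaryDecomposition (Finset.univ.map Q))
    (hp : ∀ i, ((Q i).colon Set.univ).radical = p i) :
    N.indexOfReducibility = ∑ i, (Q i).indexOfReducibility ↔
      ∀ i, N.IsEmbeddedPrime (p i) → N.IsMaximalEmbeddedComponent (p i) (Q i) := by
  simpa [hp] using theorem3p2_general hQ
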